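/- Let $E$ be a real or complex Banach space that contains no copy of $\ell_1$, that is, no linear subspace of $E$ is isomorphic (linearly homeomorphic) to the space $\ell_1$ of absolutely summable scalar sequences. Let $F$ be a norm-closed infinite-dimensional linear subspace of the topological dual $E^*$, and let $\ell_\infty(F)$ be the Banach space of bounded $F$-valued sequences with the supremum norm. Put $$\mathcal{C} = \{(x_j^*)_{j=1}^\infty \in \ell_\infty(F) : x_j^* \to 0 \text{ in the weak}^* \text{ topology of } E^* \text{ and } \|x_j^*\| \not\to 0\}.$$ Then $\mathcal{C}$ is almost pointwise spaceable in $\ell_\infty(F)$: the set $\mathcal{C}$ is nonempty, and for every sequence $\mathbf{x}^* \in \mathcal{C}$ there is a closed infinite-dimensional linear subspace $W$ of $\ell_\infty(F)$ such that $W \subseteq \mathcal{C} \cup \{0\}$ and $W$ contains a subsequence of $\mathbf{x}^*$. -/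

import Mathlib

open Filter Topology
open scoped ENNReal

/-- `ℓ_∞(G)`: bounded `G`-valued sequences, with the supremum norm. -/
abbrev EllInfty (G : Type*) [NormedAddCommGroup G] : Type _ :=
  lp (fun _ : ℕ => G) ∞

/-- `ℓ₁` over the scalar field `𝕜`. -/
abbrev EllOne (𝕜 : Type*) [RCLike 𝕜] : Type _ :=
  lp (fun _ : ℕ => 𝕜) 1

/-- `E` contains a copy of `ℓ₁`: some linear subspace of `E` is linearly homeomorphic to `ℓ₁`. -/
def ContainsCopyEllOne (𝕜 E : Type*) [RCLike 𝕜] [NormedAddCommGroup E] [NormedSpace 𝕜 E] : Prop :=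
  ∃ S : Submodule 𝕜 E, Nonempty (EllOne 𝕜 ≃L[𝕜] S)

/-- `y` is a subsequence of `x`. -/
def IsSubseq {G : Type*} (y x : ℕ → G) : Prop :=
  ∃ φ : ℕ → ℕ, StrictMono φ ∧ y = x ∘ φ

/-- A nonvoid set `A ⊆ ℓ_∞(G)` is almost pointwise spaceable in `ℓ_∞(G)` if for every `x ∈ A` some
closed infinite dimensional subspace `W` of `ℓ_∞(G)` is contained in `A ∪ {0}` and contains a
subsequence of `x`. -/
def AlmostPointwiseSpaceable (𝕜 : Type*) {G : Type*} [RCLike 𝕜] [NormedAddCommGroup G]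
    [NormedSpace 𝕜 G] (A : Set (EllInfty G)) : Prop :=
  A.Nonempty ∧
    ∀ x ∈ A, ∃ W : Submodule 𝕜 (EllInfty G),
      IsClosed (W : Set (EllInfty G)) ∧ ¬ FiniteDimensional 𝕜 W ∧
      (W : Set (EllInfty G)) ⊆ A ∪ {0} ∧ ∃ y ∈ W, IsSubseq (y : ℕ → G) (x : ℕ → G)

/-- The bounded sequences in `F ⊆ E*` that are weak*-null in `E*` but not norm null. -/
def weakStarNullNotNormNull {𝕜 E : Type*} [RCLike 𝕜] [NormedAddCommGroup E] [NormedSpace 𝕜 E]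
    (F : Submodule 𝕜 (StrongDual 𝕜 E)) : Set (EllInfty F) :=
  {x | Tendsto (fun j => StrongDual.toWeakDual (x j : StrongDual 𝕜 E)) atTop
        (𝓝 (0 : WeakDual 𝕜 E)) ∧
      ¬ Tendsto (fun j => x j) atTop (𝓝 (0 : F))}

/-!
A sequence in the set has a subsequence `y` that is bounded below in norm. Cut its index set into
infinitely many infinite pieces: multiplying the `i`-th piece by the `i`-th entry of `a ∈ ℓ_∞`
embeds `ℓ_∞` isomorphically into `ℓ_∞(F)`, every value at `a ≠ 0` is weak*-null but not norm null,
and `a = 1` gives `y` itself.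

For nonemptiness take a bounded 1-separated sequence in `F`. If it has a weakly convergent
subsequence, differences of its terms are as required. Otherwise, by the arguments of Eberlein,
Šmulian and James, some subsequence keeps a positive distance between any convex combination of its
terms and all convex combinations of sufficiently late terms. It then suffices to find convex
combinations of tails that are weak*-Cauchy. Among all sequences of convex combinations of tails,
choose one whose weak* oscillation `δ` cannot be lowered by passing to further ones. The average of
`2 ^ k` of its subsequences still oscillates by almost `δ` at some point of the unit ball; as none
of them can oscillate by more than `δ` there, all oscillate in step, which splits each of them in
two. If `δ > 0`, the points found by iterating this span a copy of `ℓ₁`, as in Rosenthal's theorem.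
-/

section Spaceability

lemma exists_strictMono_le_norm_of_not_tendsto_zero {G : Type*} [SeminormedAddCommGroup G]
    {u : ℕ → G} (hu : ¬ Tendsto u atTop (𝓝 0)) :
    ∃ c > 0, ∃ φ : ℕ → ℕ, StrictMono φ ∧ ∀ n, c ≤ ‖u (φ n)‖ := by
  simp only [NormedAddGroup.tendsto_nhds_zero, not_forall, not_eventually, not_lt] at hu
  obtain ⟨c, hc, hfreq⟩ := hu
  exact ⟨c, hc, extraction_of_frequently_atTop hfreq⟩

variable {𝕜 G : Type*} [RCLike 𝕜] [NormedAddCommGroup G] [NormedSpace 𝕜 G]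

lemma not_finiteDimensional_ellInfty : ¬ FiniteDimensional 𝕜 (EllInfty 𝕜) := by
  intro hfin
  have hli : LinearIndependent 𝕜 fun i : ℕ => (lp.single ∞ i (1 : 𝕜) : EllInfty 𝕜) := by
    rw [linearIndependent_iff']
    intro s g hg i hi
    have hgi := congrArg (fun f : EllInfty 𝕜 => f i) hg
    rw [lp.coeFn_sum, Finset.sum_apply] at hgi
    simpa [lp.single_apply, Pi.single_apply, hi] using hgi
  have := hli.finite
  exact not_finite ℕ

lemma norm_smul_unpair_le (y : EllInfty G) (a : EllInfty 𝕜) (n : ℕ) :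
    ‖a n.unpair.1 • y n‖ ≤ ‖y‖ * ‖a‖ := by
  rw [norm_smul, mul_comm]
  gcongr
  · exact lp.norm_apply_le_norm ENNReal.top_ne_zero y n
  · exact lp.norm_apply_le_norm ENNReal.top_ne_zero a _

/-- The operator `ℓ_∞ → ℓ_∞(G)` that multiplies the `n`-th term of `y` by `a n.unpair.1`. As
`n ↦ n.unpair.1` takes every value infinitely often, each entry of `a` multiplies infinitely many
terms of `y`. -/
noncomputable def spreadMul (𝕜 : Type*) [RCLike 𝕜] [NormedSpace 𝕜 G] (y : EllInfty G) :
    EllInfty 𝕜 →L[𝕜] EllInfty G :=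
  LinearMap.mkContinuous
    { toFun := fun a => ⟨fun n => a n.unpair.1 • y n,
        memℓp_infty ⟨‖y‖ * ‖a‖, Set.forall_mem_range.2 (norm_smul_unpair_le y a)⟩⟩
      map_add' := fun a b => lp.ext <| funext fun n => add_smul (a n.unpair.1) _ (y n)
      map_smul' := fun c a => lp.ext <| funext fun n => mul_smul c (a n.unpair.1) (y n) }
    ‖y‖ fun a => lp.norm_le_of_forall_le (by positivity) (norm_smul_unpair_le y a)

lemma spreadMul_apply (y : EllInfty G) (a : EllInfty 𝕜) (n : ℕ) :
    spreadMul 𝕜 y a n = a n.unpair.1 • y n := rfl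

lemma spreadMul_apply_pair (y : EllInfty G) (a : EllInfty 𝕜) (i k : ℕ) :
    spreadMul 𝕜 y a (Nat.pair i k) = a i • y (Nat.pair i k) := by
  rw [spreadMul_apply, Nat.unpair_pair]

lemma antilipschitzWith_spreadMul {y : EllInfty G} {c : ℝ} (hc : 0 < c) (hy : ∀ n, c ≤ ‖y n‖) :
    AntilipschitzWith (Real.toNNReal c⁻¹) (spreadMul 𝕜 y) := by
  refine ContinuousLinearMap.antilipschitz_of_bound _ fun a => ?_
  rw [Real.coe_toNNReal _ (by positivity)]
  refine lp.norm_le_of_forall_le (by positivity) fun i => ?_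
  rw [inv_mul_eq_div, le_div_iff₀ hc]
  calc ‖a i‖ * c ≤ ‖a i‖ * ‖y (Nat.pair i 0)‖ := by gcongr; exact hy _
    _ = ‖spreadMul 𝕜 y a (Nat.pair i 0)‖ := by rw [spreadMul_apply_pair, norm_smul]
    _ ≤ ‖spreadMul 𝕜 y a‖ := lp.norm_apply_le_norm ENNReal.top_ne_zero _ _

lemma eq_zero_of_tendsto_spreadMul_zero {y : EllInfty G} {c : ℝ} (hc : 0 < c)
    (hy : ∀ n, c ≤ ‖y n‖) {a : EllInfty 𝕜}
    (h : Tendsto (fun n => spreadMul 𝕜 y a n) atTop (𝓝 0)) : a = 0 := by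
  refine lp.ext (funext fun i => norm_le_zero_iff.1 ?_)
  have hpair : Tendsto (Nat.pair i) atTop atTop :=
    tendsto_atTop_mono (Nat.right_le_pair i) tendsto_id
  have hlim : Tendsto (fun k => ‖spreadMul 𝕜 y a (Nat.pair i k)‖) atTop (𝓝 0) := by
    simpa using (h.comp hpair).norm
  have hle : ‖a i‖ * c ≤ 0 := ge_of_tendsto' hlim fun k => by
    rw [spreadMul_apply_pair, norm_smul]
    gcongr
    exact hy _
  exact nonpos_of_mul_nonpos_left hle hc

variable {E : Type*} [NormedAddCommGroup E] [NormedSpace 𝕜 E] {F : Submodule 𝕜 (StrongDual 𝕜 E)}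

lemma mem_weakStarNullNotNormNull_iff {x : EllInfty F} :
    x ∈ weakStarNullNotNormNull F ↔
      (∀ e, Tendsto (fun j => (x j : StrongDual 𝕜 E) e) atTop (𝓝 0)) ∧
        ¬ Tendsto (fun j => x j) atTop (𝓝 0) :=
  and_congr_left' tendsto_iff_forall_eval_tendsto_topDualPairing

lemma spreadMul_mem_weakStarNullNotNormNull {y : EllInfty F}
    (hy : ∀ e, Tendsto (fun n => (y n : StrongDual 𝕜 E) e) atTop (𝓝 0)) {c : ℝ} (hc : 0 < c)
    (hyc : ∀ n, c ≤ ‖y n‖) {a : EllInfty 𝕜} (ha : a ≠ 0) :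
    spreadMul 𝕜 y a ∈ weakStarNullNotNormNull F := by
  refine mem_weakStarNullNotNormNull_iff.2
    ⟨fun e => ?_, fun h => ha (eq_zero_of_tendsto_spreadMul_zero hc hyc h)⟩
  have ha_bdd : IsBoundedUnder (· ≤ ·) atTop fun n : ℕ => ‖a n.unpair.1‖ :=
    isBoundedUnder_of ⟨‖a‖, fun n => lp.norm_apply_le_norm ENNReal.top_ne_zero a _⟩
  exact isBoundedUnder_le_mul_tendsto_zero ha_bdd (hy e)

lemma exists_closed_subspace_subset_weakStarNullNotNormNull {x : EllInfty F}
    (hx : x ∈ weakStarNullNotNormNull F) :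
    ∃ W : Submodule 𝕜 (EllInfty F),
      IsClosed (W : Set (EllInfty F)) ∧ ¬ FiniteDimensional 𝕜 W ∧
      (W : Set (EllInfty F)) ⊆ weakStarNullNotNormNull F ∪ {0} ∧
      ∃ y ∈ W, IsSubseq (y : ℕ → F) (x : ℕ → F) := by
  obtain ⟨hx0, hx_norm⟩ := mem_weakStarNullNotNormNull_iff.1 hx
  obtain ⟨c, hc, φ, hφ, hφc⟩ := exists_strictMono_le_norm_of_not_tendsto_zero (G := F) hx_norm
  let y : EllInfty F := ⟨fun n => x (φ n), memℓp_infty ⟨‖x‖,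
    Set.forall_mem_range.2 fun n => lp.norm_apply_le_norm ENNReal.top_ne_zero x _⟩⟩
  have hanti := antilipschitzWith_spreadMul (𝕜 := 𝕜) (y := y) hc hφc
  refine ⟨(spreadMul 𝕜 y).range, ?_, fun hfin => ?_, ?_, y, ⟨1, ?_⟩, φ, hφ, rfl⟩
  · exact hanti.isClosed_range (spreadMul 𝕜 y).uniformContinuous
  · exact not_finiteDimensional_ellInfty
      (Module.Finite.equiv
        (LinearEquiv.ofInjective (spreadMul 𝕜 y).toLinearMap hanti.injective).symm)
  · rintro _ ⟨a, rfl⟩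
    rcases eq_or_ne a 0 with rfl | ha
    · exact Or.inr (map_zero _)
    · exact Or.inl <| spreadMul_mem_weakStarNullNotNormNull (y := y)
        (fun e => (hx0 e).comp hφ.tendsto_atTop) hc hφc ha
  · exact lp.ext <| funext fun n => one_smul 𝕜 (y n)

end Spaceability

section EllOneEmbedding

variable {𝕜 E : Type*} [RCLike 𝕜] [NormedAddCommGroup E] [NormedSpace 𝕜 E]

lemma hasSum_norm_ellOne (c : EllOne 𝕜) : HasSum (fun i => ‖c i‖) ‖c‖ := by
  simpa using lp.hasSum_norm (p := 1) (by simp) c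

lemma norm_smul_le_norm_of_norm_le_one {v : E} (hv : ‖v‖ ≤ 1) (c : 𝕜) : ‖c • v‖ ≤ ‖c‖ :=
  norm_smul c v ▸ mul_le_of_le_one_right (norm_nonneg c) hv

variable [CompleteSpace E]

lemma hasSum_smul_of_forall_norm_le_one {e : ℕ → E} (he : ∀ i, ‖e i‖ ≤ 1) (c : EllOne 𝕜) :
    HasSum (fun i => c i • e i) (∑' i, c i • e i) :=
  (Summable.of_norm_bounded (hasSum_norm_ellOne c).summable
    fun i => norm_smul_le_norm_of_norm_le_one (he i) (c i)).hasSum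

/-- The synthesis operator `c ↦ ∑ i, c i • e i` from `ℓ₁` to `E` of a sequence `e` in the unit
ball. -/
noncomputable def ellOneSynthesis (e : ℕ → E) (he : ∀ i, ‖e i‖ ≤ 1) : EllOne 𝕜 →L[𝕜] E :=
  LinearMap.mkContinuous
    { toFun := fun c => ∑' i, c i • e i
      map_add' := fun a b => HasSum.tsum_eq <| by
        simpa only [lp.coeFn_add, Pi.add_apply, add_smul] using
          (hasSum_smul_of_forall_norm_le_one he a).add (hasSum_smul_of_forall_norm_le_one he b)
      map_smul' := fun r a => HasSum.tsum_eq <| by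
        simpa only [lp.coeFn_smul, Pi.smul_apply, smul_assoc, RingHom.id_apply] using
          (hasSum_smul_of_forall_norm_le_one he a).const_smul r }
    1 fun c => (one_mul ‖c‖).symm ▸ (hasSum_smul_of_forall_norm_le_one he c).norm_le_of_bounded
      (hasSum_norm_ellOne c) fun i => norm_smul_le_norm_of_norm_le_one (he i) (c i)

lemma hasSum_ellOneSynthesis {e : ℕ → E} (he : ∀ i, ‖e i‖ ≤ 1) (c : EllOne 𝕜) :
    HasSum (fun i => c i • e i) (ellOneSynthesis e he c) :=
  hasSum_smul_of_forall_norm_le_one he c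

lemma containsCopyEllOne_of_lower_bound {e : ℕ → E} (he : ∀ i, ‖e i‖ ≤ 1) {κ : ℝ} (hκ : 0 < κ)
    (h : ∀ (k : ℕ) (c : Fin k → 𝕜), κ * ∑ i, ‖c i‖ ≤ ‖∑ i, c i • e i‖) :
    ContainsCopyEllOne 𝕜 E := by
  let T : EllOne 𝕜 →L[𝕜] E := ellOneSynthesis e he
  have hlower : ∀ c, κ * ‖c‖ ≤ ‖T c‖ := fun c =>
    le_of_tendsto_of_tendsto' ((hasSum_norm_ellOne c).tendsto_sum_nat.const_mul κ)
      (hasSum_ellOneSynthesis he c).tendsto_sum_nat.norm fun k => by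
        simpa only [Finset.sum_range] using h k fun i => c i
  have hanti : AntilipschitzWith (Real.toNNReal κ⁻¹) T :=
    ContinuousLinearMap.antilipschitz_of_bound _ fun c => by
      rw [Real.coe_toNNReal _ (by positivity), inv_mul_eq_div, le_div_iff₀ hκ, mul_comm]
      exact hlower c
  exact ⟨_, ⟨T.equivRange hanti.injective (hanti.isClosed_range T.uniformContinuous)⟩⟩

end EllOneEmbedding

section WeakDichotomy

variable {𝕜 X : Type*} [RCLike 𝕜] [NormedAddCommGroup X] [NormedSpace 𝕜 X]

lemma exists_weakStar_limit_of_norm_le {ι : Type*} {f : ι → StrongDual 𝕜 X} {M : ℝ}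
    (hf : ∀ n, ‖f n‖ ≤ M) (U : Ultrafilter ι) :
    ∃ z : StrongDual 𝕜 X, ‖z‖ ≤ M ∧ ∀ v, Tendsto (fun n => f n v) U (𝓝 (z v)) := by
  have hball : ∀ n, StrongDual.toWeakDual (f n) ∈
      WeakDual.toStrongDual ⁻¹' Metric.closedBall (0 : StrongDual 𝕜 X) M := fun n =>
    (mem_closedBall_zero_iff (E := StrongDual 𝕜 X)).2 (hf n)
  obtain ⟨z, hzM, hz⟩ := (WeakDual.isCompact_closedBall (𝕜 := 𝕜) (E := X) 0 M).ultrafilter_le_nhds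
    (U.map fun n => StrongDual.toWeakDual (f n))
    (tendsto_principal.2 (Eventually.of_forall hball))
  exact ⟨WeakDual.toStrongDual z, (mem_closedBall_zero_iff (E := StrongDual 𝕜 X)).1 hzM,
    tendsto_iff_forall_eval_tendsto_topDualPairing.1 hz⟩

lemma exists_mem_span_norm_sub_eq_norm_restrict {ι : Type*} [Finite ι] (f : ι → StrongDual 𝕜 X)
    (z : StrongDual 𝕜 X) :
    ∃ g ∈ Submodule.span 𝕜 (Set.range f),
      ‖z - g‖ = ‖z.comp (⨅ i, (f i).ker : Submodule 𝕜 X).subtypeL‖ := by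
  obtain ⟨h, hh, hnorm⟩ :=
    exists_extension_norm_eq (⨅ i, (f i).ker) (z.comp (⨅ i, (f i).ker : Submodule 𝕜 X).subtypeL)
  have hker : (⨅ i, (f i).ker) ≤ (z - h).ker := fun v hv => by
    have : h v = z v := hh ⟨v, hv⟩
    simp [this]
  refine ⟨z - h, ?_, by rwa [sub_sub_cancel]⟩
  rw [← Submodule.apply_mem_span_image_iff_mem_span (f := ContinuousLinearMap.coeLM 𝕜)
    ContinuousLinearMap.coe_injective, ← Set.range_comp]
  exact mem_span_of_iInf_ker_le_ker hker

lemma exists_lt_re_apply_of_forall_lt_norm_sub {ι : Type*} [Finite ι] {f : ι → StrongDual 𝕜 X}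
    {z : StrongDual 𝕜 X} {r : ℝ} (hz : ∀ g ∈ Submodule.span 𝕜 (Set.range f), r < ‖z - g‖) :
    ∃ v : X, ‖v‖ ≤ 1 ∧ (∀ i, f i v = 0) ∧ r < RCLike.re (z v) := by
  obtain ⟨g, hg, hnorm⟩ := exists_mem_span_norm_sub_eq_norm_restrict f z
  obtain ⟨v, hv, hrv⟩ := ContinuousLinearMap.exists_lt_apply_of_lt_opNorm _ (hnorm ▸ hz g hg)
  obtain ⟨u, hu, huz⟩ := RCLike.exists_norm_eq_mul_self (z v)
  refine ⟨u • v, ?_, fun i => ?_, ?_⟩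
  · rw [norm_smul, hu, one_mul]
    exact hv.le
  · have hiv : f i v = 0 := (Submodule.mem_iInf _).1 v.2 i
    rw [map_smul, hiv, smul_zero]
  · rw [map_smul, smul_eq_mul, ← huz, RCLike.ofReal_re]
    exact hrv

lemma exists_annihilating_functional {ι : Type*} [Finite ι] {z : StrongDual 𝕜 (StrongDual 𝕜 X)}
    {r : ℝ} (hz : ∀ v : X, r < ‖z - NormedSpace.inclusionInDoubleDual 𝕜 X v‖) (v : ι → X) :
    ∃ φ : StrongDual 𝕜 X, ‖φ‖ ≤ 1 ∧ (∀ i, φ (v i) = 0) ∧ r < RCLike.re (z φ) := by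
  refine exists_lt_re_apply_of_forall_lt_norm_sub
    (f := fun i => NormedSpace.inclusionInDoubleDual 𝕜 X (v i)) fun g hg => ?_
  have hspan : Submodule.span 𝕜 (Set.range fun i => NormedSpace.inclusionInDoubleDual 𝕜 X (v i)) ≤
      (NormedSpace.inclusionInDoubleDual 𝕜 X).range :=
    Submodule.span_le.2 (Set.range_subset_iff.2 fun i => ⟨v i, rfl⟩)
  obtain ⟨w, rfl⟩ := hspan hg
  exact hz w

/-- A sequence separated in the manner of James: `φ j` vanishes on the terms of `x` before `j` and
has real part at least `θ` on the terms from `j` on. -/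
def IsJamesSeq (θ : ℝ) (x : ℕ → X) (φ : ℕ → StrongDual 𝕜 X) : Prop :=
  (∀ j, ‖φ j‖ ≤ 1) ∧ (∀ j k, k < j → φ j (x k) = 0) ∧ ∀ j k, j ≤ k → θ ≤ RCLike.re (φ j (x k))

lemma exists_isJamesSeq_of_bidual_limit {x : ℕ → X} {U : Ultrafilter ℕ}
    {z : StrongDual 𝕜 (StrongDual 𝕜 X)}
    (hlim : ∀ φ : StrongDual 𝕜 X, Tendsto (fun n => φ (x n)) U (𝓝 (z φ))) {r : ℝ}
    (hz : ∀ v : X, r < ‖z - NormedSpace.inclusionInDoubleDual 𝕜 X v‖) :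
    ∃ (ψ : ℕ → ℕ) (φ : ℕ → StrongDual 𝕜 X), IsJamesSeq r (x ∘ ψ) φ := by
  obtain ⟨f, hself, hrel⟩ := exists_seq_of_forall_finset_exists
    (fun p : ℕ × StrongDual 𝕜 X => ‖p.2‖ ≤ 1 ∧ r < RCLike.re (z p.2) ∧ r ≤ RCLike.re (p.2 (x p.1)))
    (fun p q => q.2 (x p.1) = 0 ∧ r ≤ RCLike.re (p.2 (x q.1))) fun s hs => by
      obtain ⟨φ, hφ, hφ0, hφz⟩ := exists_annihilating_functional hz fun p : s => x p.1.1
      have hlarge : ∀ χ, r < RCLike.re (z χ) → ∀ᶠ n in (U : Filter ℕ), r ≤ RCLike.re (χ (x n)) :=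
        fun χ hχ => (((RCLike.continuous_re.tendsto _).comp (hlim χ)).eventually_const_lt hχ).mono
          fun _ => le_of_lt
      obtain ⟨n, hn, hns⟩ := ((hlarge φ hφz).and
        ((eventually_all_finset s).2 fun p hp => hlarge p.2 (hs p hp).2.1)).exists
      exact ⟨(n, φ), ⟨hφ, hφz, hn⟩, fun p hp => ⟨hφ0 ⟨p, hp⟩, hns p hp⟩⟩
  refine ⟨fun k => (f k).1, fun j => (f j).2, fun j => (hself j).1,
    fun j k hkj => (hrel k j hkj).1, fun j k hjk => ?_⟩
  rcases hjk.eq_or_lt with rfl | hlt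
  · exact (hself j).2.2
  · exact (hrel j k hlt).2

lemma exists_seq_separating_of_isSeparable {s : Set X} (hs : TopologicalSpace.IsSeparable s) :
    ∃ φ : ℕ → StrongDual 𝕜 X, ∀ v ∈ s, (∀ k, φ k v = 0) → v = 0 := by
  obtain ⟨D, hD_countable, hD⟩ := hs
  rcases D.eq_empty_or_nonempty with rfl | hne
  · exact ⟨0, fun v hv _ => by simpa using hD hv⟩
  obtain ⟨d, rfl⟩ := hD_countable.exists_eq_range hne
  choose φ hφ_norm hφ_apply using fun k => exists_dual_vector'' 𝕜 (d k)
  refine ⟨φ, fun v hv h0 => norm_le_zero_iff.1 (le_of_forall_pos_lt_add fun ε hε => ?_)⟩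
  obtain ⟨_, ⟨k, rfl⟩, hk⟩ := Metric.mem_closure_iff.1 (hD hv) _ (half_pos hε)
  rw [dist_eq_norm] at hk
  have hd : ‖d k‖ ≤ ‖v - d k‖ :=
    calc ‖d k‖ = ‖φ k (v - d k)‖ := by
          rw [map_sub, h0, hφ_apply, zero_sub, norm_neg, RCLike.norm_ofReal, abs_norm]
      _ ≤ ‖v - d k‖ := (φ k).le_of_opNorm_le_of_le (hφ_norm k) le_rfl |>.trans_eq (one_mul _)
  linarith [norm_le_norm_sub_add v (d k)]

lemma mem_of_forall_tendsto_dual {ι : Type*} {x : ι → X} {l : Filter ι} [l.NeBot] {v : X}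
    {G : Submodule 𝕜 X} (hG : IsClosed (G : Set X)) (hx : ∀ n, x n ∈ G)
    (hv : ∀ φ : StrongDual 𝕜 X, Tendsto (fun n => φ (x n)) l (𝓝 (φ v))) : v ∈ G := by
  have : IsClosed (G : Set X) := hG
  obtain ⟨g, -, hg⟩ := exists_dual_vector'' 𝕜 (G.mkQ v)
  have hxG : ∀ n, g (G.mkQ (x n)) = 0 := fun n => by
    rw [G.mkQ_apply, (Submodule.Quotient.mk_eq_zero G).2 (hx n), map_zero]
  have hvG : g (G.mkQ v) = 0 :=
    tendsto_nhds_unique (hv (g.comp G.mkQL)) (tendsto_const_nhds.congr fun n => (hxG n).symm)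
  rw [hg, RCLike.ofReal_eq_zero, norm_eq_zero] at hvG
  exact (Submodule.Quotient.mk_eq_zero G).1 hvG

/-- The argument of Eberlein and Šmulian. -/
lemma exists_weakly_convergent_subseq {x : ℕ → X} {M : ℝ} (hx : ∀ n, ‖x n‖ ≤ M)
    (h : ∀ U : Ultrafilter ℕ, (U : Filter ℕ) ≤ atTop →
      ∃ v : X, ∀ φ : StrongDual 𝕜 X, Tendsto (fun n => φ (x n)) U (𝓝 (φ v))) :
    ∃ (ψ : ℕ → ℕ) (v : X), StrictMono ψ ∧
      ∀ φ : StrongDual 𝕜 X, Tendsto (fun n => φ (x (ψ n))) atTop (𝓝 (φ v)) := by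
  let G := (Submodule.span 𝕜 (Set.range x)).topologicalClosure
  have hxG : ∀ n, x n ∈ G := fun n =>
    Submodule.le_topologicalClosure _ (Submodule.subset_span ⟨n, rfl⟩)
  obtain ⟨φ, hφ⟩ := exists_seq_separating_of_isSeparable (𝕜 := 𝕜) (s := (G : Set X))
    ((Set.countable_range x).isSeparable.span).closure
  obtain ⟨a, -, ψ, hψ, ha⟩ := IsCompact.tendsto_subseq
    (isCompact_univ_pi fun k => isCompact_closedBall (0 : 𝕜) (‖φ k‖ * M))
    (x := fun n k => φ k (x n)) fun n k _ =>
      mem_closedBall_zero_iff.2 ((φ k).le_opNorm_of_le (hx n))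
  rw [tendsto_pi_nhds] at ha
  have hlimit : ∀ U : Ultrafilter ℕ, (U : Filter ℕ) ≤ atTop →
      ∃ v ∈ G, (∀ k, φ k v = a k) ∧
        ∀ χ : StrongDual 𝕜 X, Tendsto (fun n => χ (x (ψ n))) U (𝓝 (χ v)) := by
    intro U hU
    obtain ⟨v, hv⟩ := h (U.map ψ) (hψ.tendsto_atTop.mono_left hU)
    exact ⟨v, mem_of_forall_tendsto_dual (Submodule.isClosed_topologicalClosure _) hxG hv,
      fun k => tendsto_nhds_unique (hv (φ k)) ((ha k).mono_left hU), hv⟩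
  obtain ⟨v, hvG, hva, -⟩ := hlimit (Ultrafilter.of atTop) (Ultrafilter.of_le _)
  refine ⟨ψ, v, hψ, fun χ => (tendsto_iff_ultrafilter ..).2 fun U hU => ?_⟩
  obtain ⟨w, hwG, hwa, hw⟩ := hlimit U hU
  have hwv : w - v = 0 := hφ _ (G.sub_mem hwG hvG) fun k => by rw [map_sub, hwa, hva, sub_self]
  rw [← sub_eq_zero.1 hwv]
  exact hw χ

lemma exists_pos_lt_dist_of_isometry {α β : Type*} [MetricSpace α] [CompleteSpace α] [Nonempty α]
    [MetricSpace β] {f : α → β} (hf : Isometry f) {z : β} (hz : z ∉ Set.range f) :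
    ∃ θ > 0, ∀ v, θ < dist z (f v) := by
  have hpos := (hf.isClosedEmbedding.isClosed_range.notMem_iff_infDist_pos
    (Set.range_nonempty f)).1 hz
  exact ⟨_, half_pos hpos, fun v =>
    (half_lt_self hpos).trans_le (Metric.infDist_le_dist_of_mem ⟨v, rfl⟩)⟩

lemma exists_weakly_convergent_subseq_or_isJamesSeq (𝕜 : Type*) [RCLike 𝕜] [NormedSpace 𝕜 X]
    [CompleteSpace X] {x : ℕ → X} {M : ℝ} (hx : ∀ n, ‖x n‖ ≤ M) :
    (∃ (ψ : ℕ → ℕ) (v : X), StrictMono ψ ∧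
      ∀ φ : StrongDual 𝕜 X, Tendsto (fun n => φ (x (ψ n))) atTop (𝓝 (φ v))) ∨
    ∃ θ > 0, ∃ (ψ : ℕ → ℕ) (φ : ℕ → StrongDual 𝕜 X), IsJamesSeq θ (x ∘ ψ) φ := by
  by_cases h : ∀ U : Ultrafilter ℕ, (U : Filter ℕ) ≤ atTop →
      ∃ v : X, ∀ φ : StrongDual 𝕜 X, Tendsto (fun n => φ (x n)) U (𝓝 (φ v))
  · exact Or.inl (exists_weakly_convergent_subseq hx h)
  push Not at h
  obtain ⟨U, -, hU⟩ := h
  obtain ⟨z, -, hz⟩ := exists_weakStar_limit_of_norm_le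
    (fun n => (NormedSpace.double_dual_bound 𝕜 X (x n)).trans (hx n)) U
  have hz_range : z ∉ Set.range (NormedSpace.inclusionInDoubleDual 𝕜 X) := by
    rintro ⟨v, rfl⟩
    obtain ⟨φ, hφ⟩ := hU v
    exact hφ (hz φ)
  obtain ⟨θ, hθ, hθz⟩ := exists_pos_lt_dist_of_isometry
    (NormedSpace.inclusionInDoubleDualLi (E := X) 𝕜).isometry hz_range
  simp only [dist_eq_norm] at hθz
  exact Or.inr ⟨θ, hθ, exists_isJamesSeq_of_bidual_limit hz hθz⟩

end WeakDichotomy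

section ConvexTails

variable {V W : Type*} [AddCommGroup V] [Module ℝ V] [AddCommGroup W] [Module ℝ W]

/-- `y` is eventually a sequence of convex combinations of tails of `x`. Asking this only of large
`n` makes the relation stable under diagonal sequences. -/
def IsConvexTail (y x : ℕ → V) : Prop :=
  ∀ᶠ n in atTop, y n ∈ convexHull ℝ (x '' Set.Ici n)

namespace IsConvexTail

variable {x y z : ℕ → V}

lemma refl (x : ℕ → V) : IsConvexTail x x :=
  Eventually.of_forall fun _ => subset_convexHull ℝ _ ⟨_, Set.self_mem_Ici, rfl⟩

lemma eventually_mem_convexHull (h : IsConvexTail y x) (N : ℕ) :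
    ∀ᶠ n in atTop, y n ∈ convexHull ℝ (x '' Set.Ici N) := by
  filter_upwards [h, eventually_ge_atTop N] with n hn hNn
  exact convexHull_mono (Set.image_mono (Set.Ici_subset_Ici.2 hNn)) hn

lemma trans (hzy : IsConvexTail z y) (hyx : IsConvexTail y x) : IsConvexTail z x := by
  filter_upwards [hzy, eventually_forall_ge_atTop.2 hyx] with n hzn hyn
  refine convexHull_min ?_ (convex_convexHull ℝ _) hzn
  rintro _ ⟨m, hm, rfl⟩
  exact convexHull_mono (Set.image_mono (Set.Ici_subset_Ici.2 hm)) (hyn m hm)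

lemma map (h : IsConvexTail y x) (f : V →ₗ[ℝ] W) : IsConvexTail (f ∘ y) (f ∘ x) := by
  filter_upwards [h] with n hn
  rw [Set.image_comp, ← f.image_convexHull]
  exact Set.mem_image_of_mem f hn

lemma exists_forall_mem_convexHull_shift (h : IsConvexTail y x) :
    ∃ N, ∀ n, y (n + N) ∈ convexHull ℝ (x '' Set.Ici n) := by
  obtain ⟨N, hN⟩ := eventually_atTop.1 h
  exact ⟨N, fun n => convexHull_mono
    (Set.image_mono (Set.Ici_subset_Ici.2 (Nat.le_add_right n N))) (hN _ (Nat.le_add_left N n))⟩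

lemma exists_diagonal {Y : ℕ → ℕ → V} (hY : ∀ k, IsConvexTail (Y (k + 1)) (Y k)) :
    ∃ z, ∀ k, IsConvexTail z (Y k) := by
  have hle : ∀ j k, j ≤ k → IsConvexTail (Y k) (Y j) := fun j k hjk => by
    induction k, hjk using Nat.le_induction with
    | base => exact refl _
    | succ k _ ih => exact (hY k).trans ih
  have hdiag : ∀ k, ∃ n, ∀ j ≤ k, Y k n ∈ convexHull ℝ (Y j '' Set.Ici k) := fun k =>
    ((eventually_all_finite (Set.finite_Iic k)).2 fun j hj =>
      (hle j k hj).eventually_mem_convexHull k).exists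
  choose ν hν using hdiag
  exact ⟨fun k => Y k (ν k), fun j => eventually_atTop.2 ⟨j, fun k hjk => hν k j hjk⟩⟩

end IsConvexTail

/-- The ordering principle of Brezis and Browder. -/
lemma exists_rel_forall_rel_eq {α : Type*} {r : α → α → Prop} (hrefl : ∀ a, r a a)
    (htrans : ∀ a b c, r a b → r b c → r a c)
    (hchain : ∀ a : ℕ → α, (∀ k, r (a (k + 1)) (a k)) → ∃ b, ∀ k, r b (a k))
    {f : α → ℝ≥0∞} (hf : ∀ a b, r a b → f a ≤ f b) (x : α) :
    ∃ y, r y x ∧ ∀ z, r z y → f z = f y := by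
  have hnear : ∀ (k : ℕ) (a : α), ∃ b, r b a ∧ ∀ c, r c a → f b ≤ f c + (k : ℝ≥0∞)⁻¹ := by
    intro k a
    rcases eq_or_ne (⨅ c : {c // r c a}, f c) ⊤ with htop | htop
    · exact ⟨a, hrefl a, fun c hc => by simp [iInf_eq_top.1 htop ⟨c, hc⟩]⟩
    · obtain ⟨b, hb⟩ := iInf_lt_iff.1 (ENNReal.lt_add_right htop
        (ENNReal.inv_ne_zero.2 (ENNReal.natCast_ne_top k)))
      exact ⟨b, b.2, fun c hc => hb.le.trans (by gcongr; exact iInf_le _ (⟨c, hc⟩ : {c // r c a}))⟩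
  choose g hg_rel hg_le using hnear
  let a : ℕ → α := fun k => Nat.rec x g k
  obtain ⟨y, hy⟩ := hchain a fun k => hg_rel k (a k)
  refine ⟨y, hy 0, fun z hz => le_antisymm (hf z y hz) ?_⟩
  have hle : ∀ k : ℕ, f y ≤ f z + (k : ℝ≥0∞)⁻¹ := fun k =>
    (hf _ _ (hy (k + 1))).trans (hg_le k (a k) z (htrans _ _ _ hz (hy k)))
  simpa using ge_of_tendsto' (tendsto_const_nhds.add ENNReal.tendsto_inv_nat_nhds_zero) hle

end ConvexTails

section Oscillation

/-- The oscillation at infinity of a sequence: the limit of the diameters of its tails. -/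
noncomputable def oscAtTop {α : Type*} [PseudoEMetricSpace α] (u : ℕ → α) : ℝ≥0∞ :=
  ⨅ N, Metric.ediam (u '' Set.Ici N)

section

variable {α : Type*} [PseudoEMetricSpace α] {u : ℕ → α}

lemma exists_lt_edist_of_lt_oscAtTop {d : ℝ≥0∞} (hd : d < oscAtTop u) (N : ℕ) :
    ∃ p ≥ N, ∃ q ≥ N, d < edist (u p) (u q) := by
  by_contra! hle
  refine hd.not_ge (iInf_le_of_le N (Metric.ediam_le ?_))
  rintro _ ⟨p, hp, rfl⟩ _ ⟨q, hq, rfl⟩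
  exact hle p hp q hq

lemma cauchySeq_of_oscAtTop_eq_zero (hu : oscAtTop u = 0) : CauchySeq u := by
  refine EMetric.cauchySeq_iff.2 fun ε hε => ?_
  obtain ⟨N, hN⟩ := iInf_lt_iff.1 (hu.trans_lt hε)
  exact ⟨N, fun p hp q hq =>
    (Metric.edist_le_ediam_of_mem (Set.mem_image_of_mem u hp)
      (Set.mem_image_of_mem u hq)).trans_lt hN⟩

lemma edist_le_oscAtTop_of_tendsto {ι : Type*} {l : Filter ι} [l.NeBot] {p q : ι → ℕ}
    (hp : Tendsto p l atTop) (hq : Tendsto q l atTop) {a b : α}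
    (ha : Tendsto (fun n => u (p n)) l (𝓝 a)) (hb : Tendsto (fun n => u (q n)) l (𝓝 b)) :
    edist a b ≤ oscAtTop u := by
  refine le_iInf fun N => ?_
  have hmem : ∀ {r : ι → ℕ} {c : α}, Tendsto r l atTop → Tendsto (fun n => u (r n)) l (𝓝 c) →
      c ∈ closure (u '' Set.Ici N) := fun hr hc => mem_closure_of_tendsto hc <|
    (hr.eventually_ge_atTop N).mono fun _ hn => Set.mem_image_of_mem u hn
  rw [← Metric.ediam_closure]
  exact Metric.edist_le_ediam_of_mem (hmem hp ha) (hmem hq hb)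

end

lemma oscAtTop_le_of_norm_le {V : Type*} [SeminormedAddCommGroup V] {u : ℕ → V} {M : ℝ}
    (hu : ∀ n, ‖u n‖ ≤ M) : oscAtTop u ≤ ENNReal.ofReal (M + M) := by
  refine iInf_le_of_le 0 (Metric.ediam_le ?_)
  rintro _ ⟨p, -, rfl⟩ _ ⟨q, -, rfl⟩
  rw [edist_dist, dist_eq_norm]
  exact ENNReal.ofReal_le_ofReal (norm_sub_le_of_le (hu p) (hu q))

lemma norm_le_of_mem_convexHull {V : Type*} [SeminormedAddCommGroup V] [NormedSpace ℝ V]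
    {s : Set V} {u : V} {M : ℝ} (hs : ∀ v ∈ s, ‖v‖ ≤ M) (hu : u ∈ convexHull ℝ s) : ‖u‖ ≤ M :=
  mem_closedBall_zero_iff.1 <|
    convexHull_min (fun v hv => mem_closedBall_zero_iff.2 (hs v hv)) (convex_closedBall 0 M) hu

lemma IsConvexTail.oscAtTop_le {V : Type*} [SeminormedAddCommGroup V] [NormedSpace ℝ V]
    {y x : ℕ → V} (h : IsConvexTail y x) : oscAtTop y ≤ oscAtTop x := by
  refine le_iInf fun N => ?_
  obtain ⟨n, hn⟩ := eventually_atTop.1 (h.eventually_mem_convexHull N)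
  rw [← convexHull_ediam]
  exact iInf_le_of_le n (Metric.ediam_mono (Set.image_subset_iff.2 hn))

variable {𝕜 E : Type*} [RCLike 𝕜] [NormedAddCommGroup E] [NormedSpace 𝕜 E]

/-- The supremum over the unit ball of the pointwise oscillations at infinity of a sequence of
functionals. -/
noncomputable def weakStarOsc (y : ℕ → StrongDual 𝕜 E) : ℝ≥0∞ :=
  ⨆ e ∈ Metric.closedBall (0 : E) 1, oscAtTop fun n => y n e

variable {y z : ℕ → StrongDual 𝕜 E}

lemma oscAtTop_apply_le_weakStarOsc (y : ℕ → StrongDual 𝕜 E) {e : E} (he : ‖e‖ ≤ 1) :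
    oscAtTop (fun n => y n e) ≤ weakStarOsc y :=
  le_iSup₂_of_le e (mem_closedBall_zero_iff.2 he) le_rfl

lemma IsConvexTail.apply (h : IsConvexTail z y) (e : E) :
    IsConvexTail (fun n => z n e) fun n => y n e :=
  h.map ((NormedSpace.inclusionInDoubleDual 𝕜 E e).toLinearMap.restrictScalars ℝ)

lemma IsConvexTail.weakStarOsc_le (h : IsConvexTail z y) : weakStarOsc z ≤ weakStarOsc y :=
  iSup₂_mono fun e _ => (h.apply e).oscAtTop_le

lemma weakStarOsc_ne_top_of_norm_le {M : ℝ} (hy : ∀ n, ‖y n‖ ≤ M) : weakStarOsc y ≠ ⊤ := by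
  refine ne_top_of_le_ne_top ENNReal.ofReal_ne_top
    (iSup₂_le fun e he => oscAtTop_le_of_norm_le (M := M) fun n => ?_)
  exact ((y n).le_of_opNorm_le_of_le (hy n) (mem_closedBall_zero_iff.1 he)).trans_eq (mul_one M)

lemma cauchySeq_apply_of_weakStarOsc_eq_zero (hy : weakStarOsc y = 0) (e : E) :
    CauchySeq fun n => y n e := by
  obtain ⟨c, hc, hce⟩ : ∃ c : 𝕜, c ≠ 0 ∧ ‖c • e‖ ≤ 1 := by
    have hpos : 0 < ‖e‖ + 1 := by positivity
    refine ⟨((‖e‖ + 1)⁻¹ : ℝ), RCLike.ofReal_ne_zero.2 (inv_ne_zero hpos.ne'), ?_⟩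
    rw [norm_smul, RCLike.norm_of_nonneg (inv_nonneg.2 hpos.le), inv_mul_le_one₀ hpos]
    exact (lt_add_one _).le
  have hcauchy : CauchySeq fun n => y n (c • e) := cauchySeq_of_oscAtTop_eq_zero <|
    le_antisymm ((oscAtTop_apply_le_weakStarOsc y hce).trans_eq hy) bot_le
  have hscale := (uniformContinuous_const_smul c⁻¹).comp_cauchySeq hcauchy
  simpa only [Function.comp_def, map_smul, inv_smul_smul₀ hc] using hscale

/-- The weak* oscillation of `y` does not decrease under passing to convex tails. -/
def IsOscStable (y : ℕ → StrongDual 𝕜 E) : Prop :=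
  ∀ z, IsConvexTail z y → weakStarOsc z = weakStarOsc y

lemma exists_isConvexTail_isOscStable (x : ℕ → StrongDual 𝕜 E) :
    ∃ y, IsConvexTail y x ∧ IsOscStable y :=
  exists_rel_forall_rel_eq IsConvexTail.refl (fun _ _ _ => IsConvexTail.trans)
    (fun _ => IsConvexTail.exists_diagonal) (fun _ _ => IsConvexTail.weakStarOsc_le) x

lemma IsOscStable.of_isConvexTail (hy : IsOscStable y) (hz : IsConvexTail z y) : IsOscStable z :=
  fun w hw => (hy w (hw.trans hz)).trans (hy z hz).symm

end Oscillation

section Splitting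

lemma le_of_card_mul_le_sum_diag {ι : Type*} [Fintype ι] {r : ι → ι → ℝ} {δ ε : ℝ}
    (hr : ∀ t t', r t t' ≤ δ) (hcross : ∀ t t', r t t' + r t' t = r t t + r t' t')
    (hsum : Fintype.card ι * (δ - ε) ≤ ∑ t, r t t) (t t' : ι) :
    δ - 2 * Fintype.card ι * ε ≤ r t t' := by
  have hdiag : ∀ u, δ - Fintype.card ι * ε ≤ r u u := fun u => by
    have hle : δ - r u u ≤ ∑ v, (δ - r v v) :=
      Finset.single_le_sum (fun v _ => sub_nonneg.2 (hr v v)) (Finset.mem_univ u)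
    rw [Finset.sum_sub_distrib, Finset.sum_const, Finset.card_univ, nsmul_eq_mul] at hle
    linarith
  linarith [hdiag t, hdiag t', hcross t t', hr t' t]

lemma exists_norm_eq_one_forall_le_re_mul_sub {𝕜 ι : Type*} [RCLike 𝕜] [Fintype ι]
    {α β : ι → 𝕜} {δ ε : ℝ} (hle : ∀ t t', ‖α t - β t'‖ ≤ δ)
    (hsum : Fintype.card ι * (δ - ε) ≤ ‖∑ t, (α t - β t)‖) :
    ∃ u : 𝕜, ‖u‖ = 1 ∧ ∀ t t', δ - 2 * Fintype.card ι * ε ≤ RCLike.re (u * (α t - β t')) := by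
  obtain ⟨u, hu, hum⟩ := RCLike.exists_norm_eq_mul_self (∑ t, (α t - β t))
  refine ⟨u, hu, le_of_card_mul_le_sum_diag (fun t t' => ?_) (fun t t' => ?_) ?_⟩
  · exact (RCLike.re_le_norm _).trans (by simpa only [norm_mul, hu, one_mul] using hle t t')
  · simp only [← map_add, ← mul_add]
    congr 2
    ring
  · rwa [← map_sum, ← Finset.mul_sum, ← hum, RCLike.ofReal_re]

lemma isConvexTail_average {V ι : Type*} [AddCommGroup V] [Module ℝ V] [Fintype ι] [Nonempty ι]
    (y : ℕ → V) {s : ι → ℕ → ℕ} (hs : ∀ t n, n ≤ s t n) :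
    IsConvexTail (fun n => ∑ t, (Fintype.card ι : ℝ)⁻¹ • y (s t n)) y := by
  refine Eventually.of_forall fun n => (convex_convexHull ℝ _).sum_mem
    (fun _ _ => by positivity) ?_ fun t _ => subset_convexHull ℝ _ ⟨s t n, hs t n, rfl⟩
  rw [Finset.sum_const, Finset.card_univ, nsmul_eq_mul, mul_inv_cancel₀ (by positivity)]

lemma exists_strictMono_forall_tendsto {V ι : Type*} [SeminormedAddCommGroup V] [ProperSpace V]
    [Finite ι] {u : ι → ℕ → V} {M : ℝ} (hu : ∀ t n, ‖u t n‖ ≤ M) :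
    ∃ ψ : ℕ → ℕ, StrictMono ψ ∧ ∃ a : ι → V, ∀ t, Tendsto (u t ∘ ψ) atTop (𝓝 (a t)) := by
  cases nonempty_fintype ι
  obtain ⟨a, -, ψ, hψ, ha⟩ := tendsto_subseq_of_bounded
    (Metric.isBounded_closedBall (x := (0 : ι → V)) (r := max M 0)) (x := fun n t => u t n)
    fun n => mem_closedBall_zero_iff.2 <| (pi_norm_le_iff_of_nonneg (le_max_right _ _)).2
      fun t => (hu t n).trans (le_max_left _ _)
  exact ⟨ψ, hψ, a, tendsto_pi_nhds.1 ha⟩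

variable {𝕜 E : Type*} [RCLike 𝕜] [NormedAddCommGroup E] [NormedSpace 𝕜 E]
  {y z : ℕ → StrongDual 𝕜 E}

lemma norm_sub_le_weakStarOsc_of_tendsto {ι : Type*} {l : Filter ι} [l.NeBot] {M : ℝ}
    (hy : ∀ n, ‖y n‖ ≤ M) {v : E} (hv : ‖v‖ ≤ 1) {p q : ι → ℕ} (hp : Tendsto p l atTop)
    (hq : Tendsto q l atTop) {a b : 𝕜} (ha : Tendsto (fun n => y (p n) v) l (𝓝 a))
    (hb : Tendsto (fun n => y (q n) v) l (𝓝 b)) : ‖a - b‖ ≤ (weakStarOsc y).toReal := by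
  rw [← ENNReal.ofReal_le_iff_le_toReal (weakStarOsc_ne_top_of_norm_le hy), ← dist_eq_norm,
    ← edist_dist]
  exact (edist_le_oscAtTop_of_tendsto hp hq ha hb).trans (oscAtTop_apply_le_weakStarOsc y hv)

lemma IsOscStable.exists_lt_norm_apply_sub (hy : IsOscStable y) (hz : IsConvexTail z y) {d : ℝ}
    (hd₀ : 0 ≤ d) (hd : d < (weakStarOsc y).toReal) :
    ∃ v : E, ‖v‖ ≤ 1 ∧ ∀ n, ∃ p ≥ n, ∃ q ≥ n, d < ‖z p v - z q v‖ := by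
  have hlt : ENNReal.ofReal d < weakStarOsc z := by
    rw [hy z hz, ENNReal.ofReal_lt_iff_lt_toReal hd₀]
    · exact hd
    · rintro htop
      simp [htop, hd₀.not_gt] at hd
  obtain ⟨v, hv, hosc⟩ := lt_biSup_iff.1 hlt
  refine ⟨v, mem_closedBall_zero_iff.1 hv, fun n => ?_⟩
  obtain ⟨p, hp, q, hq, hpq⟩ := exists_lt_edist_of_lt_oscAtTop hosc n
  rw [edist_dist, dist_eq_norm, ENNReal.ofReal_lt_ofReal_iff_of_nonneg hd₀] at hpq
  exact ⟨p, hp, q, hq, hpq⟩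

lemma IsOscStable.exists_tendsto_card_mul_le_norm_sum_sub (hy : IsOscStable y) {M : ℝ}
    (hyM : ∀ n, ‖y n‖ ≤ M) {ι : Type*} [Fintype ι] [Nonempty ι] {s : ι → ℕ → ℕ}
    (hs : ∀ t n, n ≤ s t n) {d : ℝ} (hd₀ : 0 ≤ d) (hd : d < (weakStarOsc y).toReal) :
    ∃ v : E, ‖v‖ ≤ 1 ∧ ∃ p q : ℕ → ℕ, (∀ n, n ≤ p n) ∧ (∀ n, n ≤ q n) ∧ ∃ α β : ι → 𝕜,
      (∀ t, Tendsto (fun n => y (s t (p n)) v) atTop (𝓝 (α t))) ∧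
      (∀ t, Tendsto (fun n => y (s t (q n)) v) atTop (𝓝 (β t))) ∧
      Fintype.card ι * d ≤ ‖∑ t, (α t - β t)‖ := by
  obtain ⟨v, hv, hpq⟩ := hy.exists_lt_norm_apply_sub (isConvexTail_average y hs) hd₀ hd
  choose p hp q hq hpq using hpq
  have hyv : ∀ n, ‖y n v‖ ≤ M * 1 := fun n => (y n).le_of_opNorm_le_of_le (hyM n) hv
  obtain ⟨ψ, hψ, a, ha⟩ := exists_strictMono_forall_tendsto
    (u := fun (t : ι) n => (y (s t (p n)) v, y (s t (q n)) v)) fun t n => max_le (hyv _) (hyv _)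
  refine ⟨v, hv, p ∘ ψ, q ∘ ψ, fun n => hψ.le_apply.trans (hp _),
    fun n => hψ.le_apply.trans (hq _), fun t => (a t).1, fun t => (a t).2,
    fun t => (ha t).fst_nhds, fun t => (ha t).snd_nhds, ?_⟩
  have hlim := tendsto_finsetSum Finset.univ fun t _ => (ha t).fst_nhds.sub (ha t).snd_nhds
  refine ge_of_tendsto' hlim.norm fun n => ?_
  have hcard : (0 : ℝ) < Fintype.card ι := Nat.cast_pos.2 Fintype.card_pos
  have hlt := hpq (ψ n)
  rw [← sub_apply, ← Finset.smul_sum, ← Finset.smul_sum, ← smul_sub,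
    smul_apply, norm_smul, norm_inv, Real.norm_of_nonneg hcard.le,
    lt_inv_mul_iff₀ hcard, ← Finset.sum_sub_distrib, sum_apply] at hlt
  exact hlt.le

lemma IsOscStable.exists_split (hy : IsOscStable y) {M : ℝ} (hyM : ∀ n, ‖y n‖ ≤ M)
    {ι : Type*} [Finite ι] [Nonempty ι] {s : ι → ℕ → ℕ} (hs : ∀ t n, n ≤ s t n) {d : ℝ}
    (hd₀ : 0 ≤ d) (hd : d < (weakStarOsc y).toReal) :
    ∃ v : E, ‖v‖ ≤ 1 ∧ ∃ p q : ℕ → ℕ, (∀ n, n ≤ p n) ∧ (∀ n, n ≤ q n) ∧ ∃ α β : ι → 𝕜,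
      (∀ t, Tendsto (fun n => y (s t (p n)) v) atTop (𝓝 (α t))) ∧
      (∀ t, Tendsto (fun n => y (s t (q n)) v) atTop (𝓝 (β t))) ∧
      ∀ t t', d ≤ RCLike.re (α t - β t') := by
  cases nonempty_fintype ι
  set δ := (weakStarOsc y).toReal
  have hcard : (1 : ℝ) ≤ Fintype.card ι := Nat.one_le_cast.2 Fintype.card_pos
  set ε := (δ - d) / (2 * Fintype.card ι)
  have hε : 0 < ε := div_pos (sub_pos.2 hd) (by positivity)
  have hcardε : 2 * Fintype.card ι * ε = δ - d := mul_div_cancel₀ _ (by positivity)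
  have hdε : d ≤ δ - ε := by nlinarith
  obtain ⟨v, hv, p, q, hp, hq, α, β, hα, hβ, hsum⟩ :=
    hy.exists_tendsto_card_mul_le_norm_sum_sub hyM hs (hd₀.trans hdε) (sub_lt_self δ hε)
  obtain ⟨u, hu, hre⟩ := exists_norm_eq_one_forall_le_re_mul_sub (fun t t' =>
    norm_sub_le_weakStarOsc_of_tendsto hyM hv
      (tendsto_atTop_mono (fun n => (hp n).trans (hs t _)) tendsto_id)
      (tendsto_atTop_mono (fun n => (hq n).trans (hs t' _)) tendsto_id) (hα t) (hβ t')) hsum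
  refine ⟨u • v, by rwa [norm_smul, hu, one_mul], p, q, hp, hq,
    fun t => u * α t, fun t => u * β t, fun t => ?_, fun t => ?_, fun t t' => ?_⟩
  · simpa only [map_smul, smul_eq_mul] using (hα t).const_smul u
  · simpa only [map_smul, smul_eq_mul] using (hβ t).const_smul u
  · rw [← mul_sub]
    linarith [hre t t']

end Splitting

section DyadicSplitting

lemma exists_seq_of_forall_exists_snoc {α : Type*} {P : ∀ k, (Fin k → α) → Prop}
    (h₀ : P 0 Fin.elim0) (hsucc : ∀ k e, P k e → ∃ v, P (k + 1) (Fin.snoc (α := fun _ => α) e v)) :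
    ∃ e : ℕ → α, ∀ k, P k fun i => e i := by
  choose next hnext using hsucc
  let Y : ∀ k, {e : Fin k → α // P k e} :=
    Nat.rec ⟨Fin.elim0, h₀⟩ fun k e => ⟨Fin.snoc e.1 (next k e.1 e.2), hnext k e.1 e.2⟩
  have hY : ∀ k, (Y k).1 = fun i : Fin k => next i (Y i).1 (Y i).2 := fun k => by
    induction k with
    | zero => exact Subsingleton.elim _ _
    | succ k ih =>
      funext i
      induction i using Fin.lastCases with
      | last => exact Fin.snoc_last (α := fun _ => α) _ (Y k).1
      | cast i => exact (Fin.snoc_castSucc (α := fun _ => α) _ (Y k).1 i).trans (congrFun ih i)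
  exact ⟨fun k => next k (Y k).1 (Y k).2, fun k => hY k ▸ (Y k).2⟩

variable {𝕜 E : Type*} [RCLike 𝕜] [NormedAddCommGroup E] [NormedSpace 𝕜 E]
  {y : ℕ → StrongDual 𝕜 E} {M d : ℝ} {k : ℕ} {e : Fin k → E}

/-- The points `e i` of the unit ball separate `2 ^ k` subsequences of `y`, one for each choice of
a side at every `e i`: the values at `e i` of each subsequence converge, and the real parts of two
such limits differ by at least `d` when opposite sides of `e i` were chosen. -/
def SplitsDyadically (y : ℕ → StrongDual 𝕜 E) (d : ℝ) {k : ℕ} (e : Fin k → E) : Prop :=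
  (∀ i, ‖e i‖ ≤ 1) ∧ ∃ (s : (Fin k → Bool) → ℕ → ℕ) (a : (Fin k → Bool) → Fin k → 𝕜),
    (∀ t n, n ≤ s t n) ∧
    (∀ t i, Tendsto (fun n => y (s t n) (e i)) atTop (𝓝 (a t i))) ∧
    ∀ t t' i, t i = true → t' i = false → d ≤ RCLike.re (a t i - a t' i)

lemma IsOscStable.exists_splitsDyadically_snoc (hy : IsOscStable y) (hyM : ∀ n, ‖y n‖ ≤ M)
    (hd₀ : 0 ≤ d) (hd : d < (weakStarOsc y).toReal) (he : SplitsDyadically y d e) :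
    ∃ v, SplitsDyadically y d (Fin.snoc (α := fun _ => E) e v) := by
  obtain ⟨he₁, s, a, hs, ha, had⟩ := he
  obtain ⟨v, hv, p, q, hp, hq, α, β, hα, hβ, hαβ⟩ := hy.exists_split hyM hs hd₀ hd
  let r : Bool → ℕ → ℕ := fun b => if b then p else q
  have hr : ∀ b n, n ≤ r b n := Bool.forall_bool.2 ⟨hq, hp⟩
  refine ⟨v, Fin.lastCases ?_ fun i => ?_, fun t n => s (Fin.init t) (r (t (Fin.last k)) n),
    fun t => Fin.snoc (α := fun _ => 𝕜) (a (Fin.init t))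
      (if t (Fin.last k) then α (Fin.init t) else β (Fin.init t)),
    fun t n => (hr _ n).trans (hs _ _), fun t => Fin.lastCases ?_ fun i => ?_,
    fun t t' => Fin.lastCases (fun ht ht' => ?_) fun i ht ht' => ?_⟩
  · simpa only [Fin.snoc_last] using hv
  · simpa only [Fin.snoc_castSucc] using he₁ i
  · simp only [Fin.snoc_last]
    cases t (Fin.last k) with
    | true => exact hα _
    | false => exact hβ _
  · simp only [Fin.snoc_castSucc]
    exact (ha _ i).comp (tendsto_atTop_mono (hr _) tendsto_id)
  · simpa only [Fin.snoc_last, ht, ht', if_true, Bool.false_eq_true, if_false] using hαβ _ _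
  · simpa only [Fin.snoc_castSucc] using had _ _ i ht ht'

lemma IsOscStable.exists_seq_splitsDyadically (hy : IsOscStable y) (hyM : ∀ n, ‖y n‖ ≤ M)
    (hd₀ : 0 ≤ d) (hd : d < (weakStarOsc y).toReal) :
    ∃ e : ℕ → E, ∀ k, SplitsDyadically y d fun i : Fin k => e i :=
  exists_seq_of_forall_exists_snoc (P := fun _ e => SplitsDyadically y d e)
    ⟨fun i => i.elim0, fun _ n => n, fun _ => Fin.elim0, fun _ _ => le_rfl,
      fun _ i => i.elim0, fun _ _ i => i.elim0⟩
    fun _ _ he => hy.exists_splitsDyadically_snoc hyM hd₀ hd he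

lemma SplitsDyadically.exists_functional (he : SplitsDyadically y d e) (hyM : ∀ n, ‖y n‖ ≤ M)
    (b : Fin k → ℝ) :
    ∃ g : StrongDual 𝕜 E, ‖g‖ ≤ M + M ∧ ∀ i, ‖g (e i)‖ ≤ (weakStarOsc y).toReal ∧
      d ≤ |RCLike.re (g (e i))| ∧ d * |b i| ≤ b i * RCLike.re (g (e i)) := by
  obtain ⟨he₁, s, a, hs, ha, had⟩ := he
  have hlim : ∀ t, ∃ G : StrongDual 𝕜 E, ‖G‖ ≤ M ∧ ∀ i, G (e i) = a t i := fun t => by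
    obtain ⟨G, hGM, hG⟩ := exists_weakStar_limit_of_norm_le (fun n => hyM (s t n)) (hyperfilter ℕ)
    exact ⟨G, hGM, fun i =>
      tendsto_nhds_unique (hG (e i)) ((ha t i).mono_left Nat.hyperfilter_le_atTop)⟩
  choose G hGM hG using hlim
  let t : Fin k → Bool := fun i => decide (0 ≤ b i)
  let t' : Fin k → Bool := fun i => !t i
  have hst : ∀ t, Tendsto (s t) atTop atTop := fun t => tendsto_atTop_mono (hs t) tendsto_id
  refine ⟨G t - G t', norm_sub_le_of_le (hGM t) (hGM t'), fun i => ?_⟩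
  rw [sub_apply, hG, hG]
  refine ⟨norm_sub_le_weakStarOsc_of_tendsto hyM (he₁ i) (hst t) (hst t') (ha t i) (ha t' i), ?_⟩
  rcases le_or_gt 0 (b i) with hb | hb
  · have hre := had t t' i (by simpa [t] using hb) (by simpa [t', t] using hb)
    rw [abs_of_nonneg hb, mul_comm]
    exact ⟨hre.trans (le_abs_self _), by gcongr⟩
  · have hre := had t' t i (by simpa [t', t] using hb) (by simpa [t] using hb)
    rw [← neg_sub, map_neg, abs_neg, abs_of_neg hb, mul_neg, ← neg_mul, mul_neg, mul_comm]
    exact ⟨hre.trans (le_abs_self _), by nlinarith⟩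

end DyadicSplitting

section EllOneFromOscillation

variable {𝕜 E : Type*} [RCLike 𝕜] [NormedAddCommGroup E] [NormedSpace 𝕜 E]

lemma norm_le_abs_re_add_abs_im (z : 𝕜) : ‖z‖ ≤ |RCLike.re z| + |RCLike.im z| := by
  refine abs_le_of_sq_le_sq' ?_ (by positivity) |>.2
  rw [RCLike.norm_sq_eq_def, add_sq, ← sq, ← sq, sq_abs, sq_abs]
  nlinarith [mul_nonneg (abs_nonneg (RCLike.re z)) (abs_nonneg (RCLike.im z))]

lemma abs_im_le_of_norm_le_of_le_abs_re {z : 𝕜} {δ : ℝ} (hδ : 0 ≤ δ) (hz : ‖z‖ ≤ δ)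
    (hre : 4 / 5 * δ ≤ |RCLike.re z|) : |RCLike.im z| ≤ 3 / 5 * δ := by
  refine abs_le_of_sq_le_sq ?_ (by positivity)
  have hnorm : ‖z‖ ^ 2 = RCLike.re z ^ 2 + RCLike.im z ^ 2 := by
    rw [RCLike.norm_sq_eq_def, sq, sq]
  have hnorm_le : ‖z‖ ^ 2 ≤ δ ^ 2 := by gcongr
  have hre_sq : (4 / 5 * δ) ^ 2 ≤ RCLike.re z ^ 2 := by
    rw [← sq_abs (RCLike.re z)]
    gcongr
  linarith

lemma mul_abs_sub_mul_abs_le {δ ε a b r s : ℝ} (hr : δ * |a| ≤ a * r) (hs : |s| ≤ ε) :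
    δ * |a| - ε * |b| ≤ a * r + b * s := by
  have habs : |b * s| ≤ ε * |b| := by
    rw [abs_mul, mul_comm]
    gcongr
  linarith [neg_le_of_abs_le habs]

variable {y : ℕ → StrongDual 𝕜 E} {M : ℝ} {k : ℕ} {e : Fin k → E}

/-- The sides are chosen by the signs of the real parts, respectively of the imaginary parts, of
the coefficients. -/
lemma SplitsDyadically.mul_sum_norm_le
    (he : SplitsDyadically y (4 / 5 * (weakStarOsc y).toReal) e) (hyM : ∀ n, ‖y n‖ ≤ M)
    (c : Fin k → 𝕜) :
    1 / 5 * (weakStarOsc y).toReal * ∑ i, ‖c i‖ ≤ 2 * ((M + M) * ‖∑ i, c i • e i‖) := by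
  set δ := (weakStarOsc y).toReal
  have him : ∀ {z : 𝕜}, ‖z‖ ≤ δ → 4 / 5 * δ ≤ |RCLike.re z| → |RCLike.im z| ≤ 3 / 5 * δ :=
    abs_im_le_of_norm_le_of_le_abs_re ENNReal.toReal_nonneg
  have hre_le : ∑ i, (4 / 5 * δ * |RCLike.re (c i)| - 3 / 5 * δ * |RCLike.im (c i)|) ≤
      (M + M) * ‖∑ i, c i • e i‖ := by
    obtain ⟨g, hgM, hg⟩ := he.exists_functional hyM fun i => RCLike.re (c i)
    refine le_trans ?_ ((RCLike.re_le_norm _).trans (g.le_of_opNorm_le hgM _))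
    simp only [map_sum, map_smul, smul_eq_mul, RCLike.mul_re, sub_eq_add_neg, ← neg_mul]
    refine Finset.sum_le_sum fun i _ => ?_
    obtain ⟨hnorm, habs, hmul⟩ := hg i
    simpa only [abs_neg, neg_mul, sub_eq_add_neg] using
      mul_abs_sub_mul_abs_le (b := -RCLike.im (c i)) hmul (him hnorm habs)
  have him_le : ∑ i, (4 / 5 * δ * |RCLike.im (c i)| - 3 / 5 * δ * |RCLike.re (c i)|) ≤
      (M + M) * ‖∑ i, c i • e i‖ := by
    obtain ⟨g, hgM, hg⟩ := he.exists_functional hyM fun i => RCLike.im (c i)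
    refine le_trans ?_ ((RCLike.im_le_norm _).trans (g.le_of_opNorm_le hgM _))
    simp only [map_sum, map_smul, smul_eq_mul, RCLike.mul_im]
    refine Finset.sum_le_sum fun i _ => ?_
    obtain ⟨hnorm, habs, hmul⟩ := hg i
    rw [add_comm]
    exact mul_abs_sub_mul_abs_le hmul (him hnorm habs)
  calc 1 / 5 * δ * ∑ i, ‖c i‖
      ≤ 1 / 5 * δ * ∑ i, (|RCLike.re (c i)| + |RCLike.im (c i)|) := by
        gcongr
        exact norm_le_abs_re_add_abs_im _
    _ = ∑ i, (4 / 5 * δ * |RCLike.re (c i)| - 3 / 5 * δ * |RCLike.im (c i)|) +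
        ∑ i, (4 / 5 * δ * |RCLike.im (c i)| - 3 / 5 * δ * |RCLike.re (c i)|) := by
      rw [← Finset.sum_add_distrib, Finset.mul_sum]
      exact Finset.sum_congr rfl fun i _ => by ring
    _ ≤ 2 * ((M + M) * ‖∑ i, c i • e i‖) := by linarith

lemma IsOscStable.weakStarOsc_eq_zero [CompleteSpace E] (hE : ¬ ContainsCopyEllOne 𝕜 E)
    (hy : IsOscStable y) (hyM : ∀ n, ‖y n‖ ≤ M) : weakStarOsc y = 0 := by
  by_contra hne
  set δ := (weakStarOsc y).toReal
  have hδ : 0 < δ := ENNReal.toReal_pos hne (weakStarOsc_ne_top_of_norm_le hyM)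
  obtain ⟨e, he⟩ := hy.exists_seq_splitsDyadically hyM (d := 4 / 5 * δ) (by positivity)
    (by linarith)
  have hM : 0 ≤ M := (norm_nonneg _).trans (hyM 0)
  refine hE (containsCopyEllOne_of_lower_bound (e := e) (κ := δ / (20 * (M + 1)))
    (fun i => (he (i + 1)).1 (Fin.last i)) (by positivity) fun k c => ?_)
  have hle := (he k).mul_sum_norm_le hyM c
  rw [div_mul_eq_mul_div, div_le_iff₀ (by positivity)]
  nlinarith [norm_nonneg (∑ i : Fin k, c i • e i)]

lemma exists_mem_convexHull_forall_cauchySeq_apply [CompleteSpace E]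
    (hE : ¬ ContainsCopyEllOne 𝕜 E) {x : ℕ → StrongDual 𝕜 E} (hx : ∀ n, ‖x n‖ ≤ M) :
    ∃ y : ℕ → StrongDual 𝕜 E, (∀ n, y n ∈ convexHull ℝ (x '' Set.Ici n)) ∧
      ∀ e, CauchySeq fun n => y n e := by
  obtain ⟨z, hzx, hz⟩ := exists_isConvexTail_isOscStable x
  obtain ⟨N, hN⟩ := hzx.exists_forall_mem_convexHull_shift
  have hshift : IsConvexTail (fun n => z (n + N)) z := Eventually.of_forall fun n =>
    subset_convexHull ℝ _ ⟨n + N, Nat.le_add_right n N, rfl⟩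
  exact ⟨fun n => z (n + N), hN, cauchySeq_apply_of_weakStarOsc_eq_zero <|
    (hz.of_isConvexTail hshift).weakStarOsc_eq_zero hE fun n =>
      norm_le_of_mem_convexHull (Set.forall_mem_image.2 fun m _ => hx m) (hN n)⟩

end EllOneFromOscillation

section Nonempty

lemma tendsto_sub_zero_of_cauchySeq {V : Type*} [SeminormedAddCommGroup V] {u : ℕ → V}
    (hu : CauchySeq u) {m : ℕ → ℕ} (hm : ∀ n, n ≤ m n) :
    Tendsto (fun n => u (m n) - u n) atTop (𝓝 0) := by
  have hpair : Tendsto (fun n => (m n, n)) atTop atTop := by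
    rw [← prod_atTop_atTop_eq]
    exact (tendsto_atTop_mono hm tendsto_id).prodMk tendsto_id
  refine tendsto_zero_iff_norm_tendsto_zero.2 ?_
  simpa only [← dist_eq_norm, Function.comp_def, Prod.map_apply] using
    tendsto_uniformity_iff_dist_tendsto_zero.1 (hu.tendsto_uniformity.comp hpair)

section

variable {𝕜 X : Type*} [RCLike 𝕜] [NormedAddCommGroup X] [NormedSpace 𝕜 X]
  {θ : ℝ} {x y : ℕ → X} {φ : ℕ → StrongDual 𝕜 X} {u : X}

lemma IsJamesSeq.eventually_apply_eq_zero (h : IsJamesSeq θ x φ)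
    (hu : u ∈ Submodule.span 𝕜 (Set.range x)) : ∀ᶠ j in atTop, φ j u = 0 := by
  induction hu using Submodule.span_induction with
  | mem u hu =>
    obtain ⟨k, rfl⟩ := hu
    exact (eventually_gt_atTop k).mono fun j hj => h.2.1 j k hj
  | zero => exact Eventually.of_forall fun j => map_zero (φ j)
  | add u v _ _ hu hv =>
    filter_upwards [hu, hv] with j hju hjv
    rw [map_add, hju, hjv, add_zero]
  | smul c u _ hu =>
    filter_upwards [hu] with j hj
    rw [map_smul, hj, smul_zero]

variable [NormedSpace ℝ X] [IsScalarTower ℝ 𝕜 X]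

lemma convexHull_real_subset_submodule {G : Submodule 𝕜 X} {s : Set X} (hs : s ⊆ G) :
    convexHull ℝ s ⊆ G :=
  convexHull_min hs (G.restrictScalars ℝ).convex

lemma IsJamesSeq.le_re_apply (h : IsJamesSeq θ x φ) {j : ℕ}
    (hu : u ∈ convexHull ℝ (x '' Set.Ici j)) : θ ≤ RCLike.re (φ j u) :=
  convexHull_min (t := {v | θ ≤ RCLike.re (φ j v)})
    (Set.image_subset_iff.2 fun k hk => h.2.2 j k hk)
    (convex_halfSpace_ge (RCLike.reLm ∘ₗ (φ j).toLinearMap.restrictScalars ℝ).isLinear θ) hu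

lemma IsJamesSeq.exists_le_norm_sub (h : IsJamesSeq θ x φ)
    (hy : ∀ n, y n ∈ convexHull ℝ (x '' Set.Ici n)) (n : ℕ) : ∃ m ≥ n, θ ≤ ‖y m - y n‖ := by
  have hspan : y n ∈ Submodule.span 𝕜 (Set.range x) := convexHull_real_subset_submodule
    ((Set.image_subset_range _ _).trans Submodule.subset_span) (hy n)
  obtain ⟨j, hj, hnj⟩ :=
    ((h.eventually_apply_eq_zero hspan).and (eventually_ge_atTop n)).exists
  refine ⟨j, hnj, ?_⟩
  calc θ ≤ RCLike.re (φ j (y j - y n)) := by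
        rw [map_sub, hj, sub_zero]
        exact h.le_re_apply (hy j)
    _ ≤ ‖φ j (y j - y n)‖ := RCLike.re_le_norm _
    _ ≤ 1 * ‖y j - y n‖ := (φ j).le_of_opNorm_le (h.1 j) _
    _ = ‖y j - y n‖ := one_mul _

end

variable {𝕜 E : Type*} [RCLike 𝕜] [NormedAddCommGroup E] [NormedSpace 𝕜 E]
  {F : Submodule 𝕜 (StrongDual 𝕜 E)}

lemma weakStarNullNotNormNull_nonempty_of_forall_cauchySeq_apply
    {y : ℕ → StrongDual 𝕜 E} {M θ : ℝ} (hyF : ∀ n, y n ∈ F) (hyM : ∀ n, ‖y n‖ ≤ M)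
    (hy : ∀ e, CauchySeq fun n => y n e) (hθ : 0 < θ)
    (hsep : ∀ n, ∃ m ≥ n, θ ≤ ‖y m - y n‖) : (weakStarNullNotNormNull F).Nonempty := by
  choose m hm hmθ using hsep
  let z : ℕ → F := fun n => ⟨y (m n) - y n, F.sub_mem (hyF _) (hyF _)⟩
  have hz : Memℓp z ∞ :=
    memℓp_infty ⟨M + M, Set.forall_mem_range.2 fun n => norm_sub_le_of_le (hyM _) (hyM _)⟩
  have hznull : ¬ Tendsto z atTop (𝓝 0) := fun h => hθ.not_ge <|
    ge_of_tendsto' ((tendsto_zero_iff_norm_tendsto_zero (E := F) (f := z)).1 h) hmθ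
  exact ⟨⟨z, hz⟩, mem_weakStarNullNotNormNull_iff.2
    ⟨fun e => tendsto_sub_zero_of_cauchySeq (hy e) hm, hznull⟩⟩

lemma weakStarNullNotNormNull_nonempty [CompleteSpace E] (hE : ¬ ContainsCopyEllOne 𝕜 E)
    (hFinf : ¬ FiniteDimensional 𝕜 F) : (weakStarNullNotNormNull F).Nonempty := by
  obtain ⟨R, f, -, hfR, hf⟩ := exists_seq_norm_le_one_le_norm_sub (𝕜 := 𝕜) (E := F) hFinf
  let x : ℕ → StrongDual 𝕜 E := fun n => f n
  have hxR : ∀ n, ‖x n‖ ≤ R := hfR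
  rcases exists_weakly_convergent_subseq_or_isJamesSeq 𝕜 hxR with
    ⟨ψ, v, hψ, hlim⟩ | ⟨θ, hθ, ψ, φ, hJ⟩
  · exact weakStarNullNotNormNull_nonempty_of_forall_cauchySeq_apply (y := x ∘ ψ)
      (fun n => (f (ψ n)).2) (fun n => hxR (ψ n))
      (fun e => (hlim (NormedSpace.inclusionInDoubleDual 𝕜 E e)).cauchySeq) one_pos
      fun n => ⟨n + 1, Nat.le_succ n, hf (hψ (Nat.lt_succ_self n)).ne'⟩
  · obtain ⟨y, hy, hcauchy⟩ :=
      exists_mem_convexHull_forall_cauchySeq_apply hE (x := x ∘ ψ) fun n => hxR (ψ n)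
    have hyF : ∀ n, y n ∈ F := fun n => convexHull_real_subset_submodule
      (Set.image_subset_iff.2 fun k _ => (f (ψ k)).2) (hy n)
    have hyR : ∀ n, ‖y n‖ ≤ R := fun n =>
      norm_le_of_mem_convexHull (Set.forall_mem_image.2 fun k _ => hxR (ψ k)) (hy n)
    exact weakStarNullNotNormNull_nonempty_of_forall_cauchySeq_apply hyF hyR hcauchy hθ
      (hJ.exists_le_norm_sub hy)

end Nonempty

theorem corollary3p6_general {𝕜 E : Type*} [RCLike 𝕜] [NormedAddCommGroup E] [NormedSpace 𝕜 E]
    [CompleteSpace E] (hE : ¬ ContainsCopyEllOne 𝕜 E)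
    (F : Submodule 𝕜 (StrongDual 𝕜 E)) (hFinf : ¬ FiniteDimensional 𝕜 F) :
    AlmostPointwiseSpaceable 𝕜 (weakStarNullNotNormNull F) :=
  ⟨weakStarNullNotNormNull_nonempty hE hFinf,
    fun _ hx => exists_closed_subspace_subset_weakStarNullNotNormNull hx⟩

theorem corollary3p6 {𝕜 E : Type*} [RCLike 𝕜] [NormedAddCommGroup E] [NormedSpace 𝕜 E]
    [CompleteSpace E] (hE : ¬ ContainsCopyEllOne 𝕜 E)
    (F : Submodule 𝕜 (StrongDual 𝕜 E)) (hF : IsClosed (F : Set (StrongDual 𝕜 E)))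
    (hFinf : ¬ FiniteDimensional 𝕜 F) :
    AlmostPointwiseSpaceable 𝕜 (weakStarNullNotNormNull F) :=
  corollary3p6_general hE F hFinf
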